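/- **Model.** Let $m,K\ge 1$ be integers, $d,v,b>0$, $0<w_0<w_c$, and let the payoffs satisfy $\mathbf T>\mathbf R>0$ and $\mathbf S>\mathbf P>0$. A configuration $\sigma=(X^i,Y^i,Z^i)_{1\le i\le K}$ assigns to each slot $i$ a position $X^i\in(\mathbb Z/m\mathbb Z)^2$, a wealth $Y^i\in\mathbb R$ and a behaviour $Z^i\in\{-1,0,1\}$ (not yet born, cooperator, defector). A particle $i$ is alive if $Z^i\neq-1$ and $Y^i>0$; it dies when its wealth becomes non-positive. The system $(\sigma_t)_{t\ge0}$ is the continuous-time Markov chain driven by independent Poisson clocks as follows. * Each $i$ has a clock of rate $d$; when it rings, $X^i$ jumps to one of its four neighbours $X^i\pm(1,0)$, $X^i\pm(0,1)$, each with probability $1/4$. * Each unordered pair $\{i,j\}$, $i\ne j$, has a clock of rate $v$; when it rings and $i,j$ are both alive and on the same site, they play, and their payoffs are added to their wealths: two cooperators get $\mathbf R$ each; a cooperator and a defector get $-\mathbf S$ and $\mathbf T$ respectively; of two defectors, one chosen by a fair coin gets $-2\mathbf P$ and the other gets $0$. Otherwise nothing happens. * Each $i$ has a clock of rate $b$;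 when it rings, if $Z^i\ne-1$, $Y^i>w_c$ and the set $\{j: Z^j=-1\}$ is non-empty, then $j$ is drawn uniformly from this set and $X^j\leftarrow X^i$, $Y^j\leftarrow w_0$, $Z^j\leftarrow Z^i$, $Y^i\leftarrow Y^i-w_0$. Otherwise nothing happens. Let $\mathbb P_\sigma$ be the law of the system started from $\sigma$. **Theorem.** For all integers $m,K\ge1$ and reals $d,v>0$, $0<w_0<w_c$, there are constants $\nu,\nu'>0$, depending only on $d,v,w_c,w_0,K,m$, such that for all $b>0$ and all payoffs with $\mathbf T>\mathbf R>0$, $\mathbf S>\mathbf P>0$, $$\nu(\mathbf S+w_0)<\mathbf R\quad\text{and}\quad \nu'(2\mathbf P+w_0)<\mathbf T,$$ and for every initial configuration $\sigma$ with at least two cooperators and at least one defector with positive wealth, $$\mathbb P_\sigma\bigl(\text{every cooperator and every defector alive in }\sigma\text{ is alive at all times } t\ge0\bigr)>0.$$ -/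

import Mathlib

open MeasureTheory ProbabilityTheory
open scoped NNReal ENNReal

namespace PrisonersDilemma

/-- The behaviour of a particle: a cooperator (code `0`), a defector (code `1`), or a slot whose
particle is not born yet (code `-1`). -/
inductive Strategy
  | unborn
  | cooperate
  | defect
  deriving DecidableEq

/-- The numerical data of the model, apart from the size `m` of the torus and the number `K` of
slots: the rates `d` (moves), `v` (games), `b` (births), the wealth `w_c` above which a particle can
give birth, the birth wealth `w_0`, and the payoffs `R`, `S`, `T`, `P`. -/
structure Params where
  d : ℝ
  v : ℝ
  b : ℝ
  w_c : ℝ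
  w_0 : ℝ
  R : ℝ
  S : ℝ
  T : ℝ
  P : ℝ

/-- A configuration: position `X i` on the torus `(ℤ/mℤ)²`, wealth `Y i` and behaviour `Z i` of each
of the `K` slots. -/
@[ext]
structure Config (m K : ℕ) where
  X : Fin K → ZMod m × ZMod m
  Y : Fin K → ℝ
  Z : Fin K → Strategy

/-- The particle `i` is on the torus: it is born and has positive wealth. -/
def Config.Alive {m K : ℕ} (σ : Config m K) (i : Fin K) : Prop :=
  σ.Z i ≠ Strategy.unborn ∧ 0 < σ.Y i

/-- There are at least two cooperators and at least one defector (with positive wealth). -/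
def Config.TwoCooperatorsOneDefector {m K : ℕ} (σ : Config m K) : Prop :=
  2 ≤ {i : Fin K | σ.Alive i ∧ σ.Z i = Strategy.cooperate}.ncard ∧
  1 ≤ {i : Fin K | σ.Alive i ∧ σ.Z i = Strategy.defect}.ncard

/-! ### The randomness: Poisson clocks and independent marks -/

/-- The Poisson clocks that drive the system: one clock for the moves of each particle, one for the
games of each unordered pair of distinct particles, one for the births of each particle. -/
inductive Clock (K : ℕ)
  | move (i : Fin K)
  | game (p : {p : Fin K × Fin K // p.1 < p.2})
  | birth (i : Fin K)
  deriving Fintype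

/-- The four directions in which a particle can move. -/
inductive Direction
  | top
  | bottom
  | left
  | right
  deriving DecidableEq

/-- A simultaneous choice of one element in every nonempty set of slots. A uniformly distributed
choice selects a uniformly distributed element of each such set; it is used to draw the slot of an
offspring uniformly among the free slots. -/
def SlotChoice (K : ℕ) : Type :=
  (A : {A : Finset (Fin K) // A.Nonempty}) → {j : Fin K // j ∈ A.1}

instance (K : ℕ) : MeasurableSpace (Clock K) := ⊤
instance : MeasurableSpace Direction := ⊤
instance (K : ℕ) : MeasurableSpace (SlotChoice K) := ⊤

instance : Fintype Direction :=
  ⟨{Direction.top, Direction.bottom, Direction.left, Direction.right}, by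
    intro e; cases e <;> simp⟩
instance : Nonempty Direction := ⟨Direction.top⟩
instance (K : ℕ) : Nonempty (SlotChoice K) := ⟨fun A => ⟨A.2.choose, A.2.choose_spec⟩⟩
instance (K : ℕ) : Fintype (SlotChoice K) :=
  inferInstanceAs (Fintype ((A : {A : Finset (Fin K) // A.Nonempty}) → {j : Fin K // j ∈ A.1}))

/-- What is drawn when a clock rings: which clock rings, a direction (used by moves), a fair coin
(used by games between two defectors) and a choice of slots (used by births). -/
abbrev Mark (K : ℕ) : Type := Clock K × Direction × Bool × SlotChoice K

/-- The sample space: the waiting time before, and the mark of, each successive ring. -/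
abbrev Sample (K : ℕ) : Type := ℕ → ℝ × Mark K

/-- The rate of each Poisson clock. -/
def Params.rate (π : Params) {K : ℕ} : Clock K → ℝ
  | Clock.move _ => π.d
  | Clock.game _ => π.v
  | Clock.birth _ => π.b

/-- The rate `K (d + b) + K (K - 1) / 2 * v` of the superposition of all the clocks. -/
noncomputable def Params.totalRate (π : Params) (K : ℕ) : ℝ := ∑ c : Clock K, π.rate c

/-- A ring of the superposition is a ring of the clock `c` with probability proportional to the rate
of `c`. -/
noncomputable def Params.clockLaw (π : Params) (K : ℕ) : Measure (Clock K) :=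
  ∑ c : Clock K, ENNReal.ofReal (π.rate c / π.totalRate K) • Measure.dirac c

/-- The law of a mark: the clock that rings, a uniform direction, a fair coin and a uniform choice
of slots, all independent. -/
noncomputable def Params.markLaw (π : Params) (K : ℕ) : Measure (Mark K) :=
  (π.clockLaw K).prod ((PMF.uniformOfFintype Direction).toMeasure.prod
    ((PMF.uniformOfFintype Bool).toMeasure.prod
      (PMF.uniformOfFintype (SlotChoice K)).toMeasure))

/-- The probability on the sample space. Independent Poisson clocks are realised through their
superposition: the waiting times between successive rings are independent and exponentially
distributed with the total rate, and the marks are independent, identically distributed and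
independent of the waiting times. -/
noncomputable def Params.prob (π : Params) (K : ℕ) : Measure (Sample K) :=
  Measure.infinitePi fun _ : ℕ => (expMeasure (π.totalRate K)).prod (π.markLaw K)

/-! ### The evolution -/

/-- The displacement along a direction. -/
def Direction.step {m : ℕ} : Direction → ZMod m × ZMod m
  | Direction.top => (0, 1)
  | Direction.bottom => (0, -1)
  | Direction.left => (-1, 0)
  | Direction.right => (1, 0)

/-- The payoffs of the two players of a game; the coin decides which of two defectors is
punished. -/
def Params.payoff (π : Params) (coin : Bool) : Strategy → Strategy → ℝ × ℝ
  | Strategy.cooperate, Strategy.cooperate => (π.R, π.R)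
  | Strategy.cooperate, Strategy.defect => (-π.S, π.T)
  | Strategy.defect, Strategy.cooperate => (π.T, -π.S)
  | Strategy.defect, Strategy.defect => if coin then (-2 * π.P, 0) else (0, -2 * π.P)
  | _, _ => (0, 0)

/-- Particle `i` jumps to the neighbouring site in direction `e`. -/
def Config.move {m K : ℕ} (σ : Config m K) (i : Fin K) (e : Direction) : Config m K :=
  { σ with X := Function.update σ.X i (σ.X i + e.step) }

open Classical in
/-- The clock of the pair `i`, `j` rings: if both are alive and on the same site, they play. -/
noncomputable def Config.game {m K : ℕ} (π : Params) (σ : Config m K) (i j : Fin K) (coin : Bool) :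
    Config m K :=
  if σ.X i = σ.X j ∧ σ.Alive i ∧ σ.Alive j then
    { σ with
      Y := Function.update
        (Function.update σ.Y i (σ.Y i + (π.payoff coin (σ.Z i) (σ.Z j)).1))
        j (σ.Y j + (π.payoff coin (σ.Z i) (σ.Z j)).2) }
  else σ

open Classical in
/-- The slots whose particle is not born yet. -/
noncomputable def Config.freeSlots {m K : ℕ} (σ : Config m K) : Finset (Fin K) :=
  Finset.univ.filter fun j => σ.Z j = Strategy.unborn

open Classical in
/-- The birth clock of `i` rings: if `i` is born and has wealth more than `w_c`, and if there is a
free slot, then a free slot `j` receives an offspring of `i`, on the same site, with the same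
behaviour, and with the wealth `w_0`, which is taken from the wealth of `i`. -/
noncomputable def Config.birth {m K : ℕ} (π : Params) (σ : Config m K) (i : Fin K)
    (choice : SlotChoice K) : Config m K :=
  if h : σ.Z i ≠ Strategy.unborn ∧ π.w_c < σ.Y i ∧ σ.freeSlots.Nonempty then
    let j : Fin K := (choice ⟨σ.freeSlots, h.2.2⟩).1
    { X := Function.update σ.X j (σ.X i)
      Y := Function.update (Function.update σ.Y i (σ.Y i - π.w_0)) j π.w_0
      Z := Function.update σ.Z j (σ.Z i) }
  else σ

/-- The effect of a ring. -/
noncomputable def Config.update {m K : ℕ} (π : Params) (σ : Config m K) (u : Mark K) :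
    Config m K :=
  match u.1 with
  | Clock.move i => σ.move i u.2.1
  | Clock.game p => σ.game π p.1.1 p.1.2 u.2.2.1
  | Clock.birth i => σ.birth π i u.2.2.2

/-- The configuration after the first `n` rings, from the initial configuration `σ`. -/
noncomputable def chain {m K : ℕ} (π : Params) (σ : Config m K) (ω : Sample K) : ℕ → Config m K
  | 0 => σ
  | n + 1 => (chain π σ ω n).update π (ω n).2

/-- The time of the `n`-th ring (with time `0` for `n = 0`). -/
noncomputable def ringTime {K : ℕ} (ω : Sample K) (n : ℕ) : ℝ :=
  ∑ k ∈ Finset.range n, (ω k).1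

/-- The number of rings in the time interval `[0, t]` (almost surely, there are finitely many). -/
noncomputable def ringCount {K : ℕ} (ω : Sample K) (t : ℝ≥0) : ℕ :=
  {n : ℕ | ringTime ω (n + 1) ≤ t}.ncard

/-- The particle system: the configuration at time `t`, from the initial configuration `σ`. -/
noncomputable def configAt {m K : ℕ} (π : Params) (σ : Config m K) (ω : Sample K) (t : ℝ≥0) :
    Config m K :=
  chain π σ ω (ringCount ω t)

/-- The event that the cooperators and the defectors of the initial configuration `σ` never die. -/
def neverDie {m K : ℕ} (π : Params) (σ : Config m K) : Set (Sample K) :=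
  {ω | ∀ i : Fin K, σ.Alive i → ∀ t : ℝ≥0, (configAt π σ ω t).Alive i}

end PrisonersDilemma

/-!
Time plays no role in survival: it suffices that the particles alive in `σ` are alive after each
ring. The marks of the rings are independent with finitely many values, all of positive probability,
so any finite sequence of rings may be prescribed at the start. There are at most `K` births in all,
because a slot is never freed. The prescribed rings thus make a cooperator rich and let it fill all
the free slots (`exists_reachable_all_born`), which rules out further births, whatever the rate `b`.
They then make all living particles as rich as desired (`exists_reachable_wealth_forall`):
cooperators by meeting one another, defectors by meeting cooperators that can afford it.

From then on, give to each particle `i` another cooperator `c` as a partner. When `i` and `c` are on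
the same site, their games bring `i` a gain `g` (`R` for a cooperator, `T` for a defector) at rate
`v`; its losses are at most `l` (`S`, respectively `2 * P`) per game, at total rate at most `v * K`.
To see that the gains prevail, the wealth of `i` is corrected by `a * potential (X i - X c)`, where
the potential is a function on the torus, with values in `[1, H]` for `H = 8 ^ (2 * m)`, whose mean
increases by at least `1` in a step of the walk from a site other than the origin, and decreases by
at most `H` in a step from the origin. Since `X i - X c` makes such steps at rate `2 * d`, the choice
`a = v * K * l / d` gives a positive drift at every displacement as soon as `K * (1 + 2 * H) * l < g`
(`exists_le_integral_increment`). This condition does not involve the rates, and `K * (1 + 2 * H)`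
serves as both constants of the theorem.

A bounded increment with positive drift makes `exp (-θ * correctedWealth)` a supermartingale for
small `θ > 0` (`exists_exp_supermartingale`). The sum of these functions over the living particles,
suitably normalised, is at least `1` when one of them dies and is less than `1` at the start if all
are rich enough, so by the maximal inequality (`prob_aliveForever_pos_of_supermartingale`) they
survive forever with positive probability.
-/

namespace PrisonersDilemma

/-! ### The first ring of an i.i.d. sequence -/

/-- Prepending an independent first term to an i.i.d. sequence gives an i.i.d. sequence. -/
lemma map_natCases_prod_infinitePi {E : Type*} [MeasurableSpace E] (μ : Measure E)
    [IsProbabilityMeasure μ] :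
    (μ.prod (Measure.infinitePi fun _ : ℕ => μ)).map
      (fun p n => Nat.casesOn n p.1 p.2 : E × (ℕ → E) → ℕ → E) =
      Measure.infinitePi fun _ : ℕ => μ := by
  classical
  have hmeas : Measurable (fun p n => Nat.casesOn n p.1 p.2 : E × (ℕ → E) → ℕ → E) := by
    refine measurable_pi_lambda _ fun n => ?_
    cases n with
    | zero => exact measurable_fst
    | succ n => exact (measurable_pi_apply n).comp measurable_snd
  refine Measure.eq_infinitePi _ fun s t ht => ?_
  obtain ⟨N, hN⟩ : ∃ N, s ⊆ Finset.range (N + 1) :=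
    ⟨s.sup id, fun i hi => Finset.mem_range.2 (Nat.lt_succ_of_le (Finset.le_sup (f := id) hi))⟩
  -- Enlarge the index set to an initial segment, with trivial constraints outside `s`.
  set t' : ℕ → Set E := fun i => if i ∈ s then t i else Set.univ with ht'
  have ht'm : ∀ i, MeasurableSet (t' i) := fun i => by
    by_cases h : i ∈ s <;> simp [ht', h, ht]
  have hprod : ∏ i ∈ s, μ (t i) = ∏ i ∈ Finset.range (N + 1), μ (t' i) := by
    rw [← Finset.prod_subset hN (f := fun i => μ (t' i)) (fun i _ hi => by simp [ht', hi])]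
    exact Finset.prod_congr rfl fun i hi => by simp [ht', hi]
  rw [Measure.map_apply hmeas (MeasurableSet.pi s.countable_toSet fun i _ => ht i), hprod]
  have hpre : (fun p n => Nat.casesOn n p.1 p.2 : E × (ℕ → E) → ℕ → E) ⁻¹' Set.pi s t =
      t' 0 ×ˢ Set.pi (Finset.range N) fun i => t' (i + 1) := by
    ext ⟨x, ω⟩
    simp only [Set.mem_preimage, Set.mem_pi, Set.mem_prod, Finset.mem_coe, Finset.mem_range]
    constructor
    · intro h
      refine ⟨?_, fun i _ => ?_⟩
      · by_cases h0 : 0 ∈ s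
        · simpa [ht', h0] using h 0 h0
        · simp [ht', h0]
      · by_cases h0 : i + 1 ∈ s
        · simpa [ht', h0] using h (i + 1) h0
        · simp [ht', h0]
    · rintro ⟨h1, h2⟩ i hi
      cases i with
      | zero => simpa [ht', hi] using h1
      | succ i =>
        have := h2 i (by simpa using hN hi)
        simpa [ht', hi] using this
  rw [hpre, Measure.prod_prod, Measure.infinitePi_pi _ (fun i _ => ht'm _),
    Finset.prod_range_succ', mul_comm]

/-- In an i.i.d. sequence, the first term is independent of the later ones, which again form an
i.i.d. sequence with the same law. -/
lemma infinitePi_head_tail {E : Type*} [MeasurableSpace E] (μ : Measure E)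
    [IsProbabilityMeasure μ] {A : Set E} {B : Set (ℕ → E)} (hA : MeasurableSet A)
    (hB : MeasurableSet B) :
    (Measure.infinitePi fun _ : ℕ => μ) {ω | ω 0 ∈ A ∧ (fun n => ω (n + 1)) ∈ B} =
      μ A * (Measure.infinitePi fun _ : ℕ => μ) B := by
  have hmeas : Measurable (fun p n => Nat.casesOn n p.1 p.2 : E × (ℕ → E) → ℕ → E) := by
    refine measurable_pi_lambda _ fun n => ?_
    cases n with
    | zero => exact measurable_fst
    | succ n => exact (measurable_pi_apply n).comp measurable_snd
  have hset : MeasurableSet {ω : ℕ → E | ω 0 ∈ A ∧ (fun n => ω (n + 1)) ∈ B} := by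
    refine (measurable_pi_apply 0 hA).inter ?_
    exact (measurable_pi_lambda (fun (ω : ℕ → E) n => ω (n + 1))
      fun n => measurable_pi_apply (n + 1)) hB
  rw [← Measure.prod_prod, ← map_natCases_prod_infinitePi μ, Measure.map_apply hmeas hset,
    map_natCases_prod_infinitePi μ]
  rfl

/-! ### The law of the marks -/

instance : DiscreteMeasurableSpace Direction := ⟨fun _ => trivial⟩
instance (K : ℕ) : DiscreteMeasurableSpace (Clock K) := ⟨fun _ => trivial⟩
instance (K : ℕ) : DiscreteMeasurableSpace (SlotChoice K) := ⟨fun _ => trivial⟩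

lemma Params.rate_pos {π : Params} (hd : 0 < π.d) (hv : 0 < π.v) (hb : 0 < π.b) {K : ℕ}
    (c : Clock K) : 0 < π.rate c := by
  cases c <;> assumption

lemma Params.totalRate_pos {π : Params} (hd : 0 < π.d) (hv : 0 < π.v) (hb : 0 < π.b) {K : ℕ}
    (hK : 0 < K) : 0 < π.totalRate K :=
  Finset.sum_pos (fun c _ => π.rate_pos hd hv hb c) ⟨Clock.move ⟨0, hK⟩, Finset.mem_univ _⟩

lemma Params.clockLaw_singleton (π : Params) {K : ℕ} (c : Clock K) :
    π.clockLaw K {c} = ENNReal.ofReal (π.rate c / π.totalRate K) := by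
  classical
  simp only [Params.clockLaw, Measure.coe_finsetSum, Finset.sum_apply, Measure.smul_apply,
    smul_eq_mul, Measure.dirac_apply, Set.indicator_apply, Set.mem_singleton_iff, Pi.one_apply,
    mul_ite, mul_one, mul_zero]
  simp

lemma Params.isProbabilityMeasure_clockLaw {π : Params} (hd : 0 < π.d) (hv : 0 < π.v)
    (hb : 0 < π.b) {K : ℕ} (hK : 0 < K) : IsProbabilityMeasure (π.clockLaw K) := by
  have hL := π.totalRate_pos hd hv hb hK
  refine ⟨?_⟩
  simp only [Params.clockLaw, Measure.coe_finsetSum, Finset.sum_apply, Measure.smul_apply,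
    smul_eq_mul, measure_univ, mul_one]
  rw [← ENNReal.ofReal_sum_of_nonneg fun c _ => (div_pos (π.rate_pos hd hv hb c) hL).le,
    ← Finset.sum_div]
  change ENNReal.ofReal (π.totalRate K / π.totalRate K) = 1
  rw [div_self hL.ne', ENNReal.ofReal_one]

lemma Params.isProbabilityMeasure_markLaw {π : Params} (hd : 0 < π.d) (hv : 0 < π.v)
    (hb : 0 < π.b) {K : ℕ} (hK : 0 < K) : IsProbabilityMeasure (π.markLaw K) := by
  have := π.isProbabilityMeasure_clockLaw hd hv hb hK
  unfold Params.markLaw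
  infer_instance

lemma uniformOfFintype_toMeasure_singleton_pos {E : Type*} [Fintype E] [Nonempty E]
    [MeasurableSpace E] [MeasurableSingletonClass E] (x : E) :
    0 < (PMF.uniformOfFintype E).toMeasure {x} := by
  rw [PMF.toMeasure_apply_singleton _ _ (measurableSet_singleton x), PMF.uniformOfFintype_apply]
  simp

lemma Params.markLaw_singleton_pos {π : Params} (hd : 0 < π.d) (hv : 0 < π.v) (hb : 0 < π.b)
    {K : ℕ} (hK : 0 < K) (u : Mark K) : 0 < π.markLaw K {u} := by
  have := π.isProbabilityMeasure_clockLaw hd hv hb hK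
  obtain ⟨c, e, x, s⟩ := u
  simp only [Params.markLaw, ← Set.singleton_prod_singleton, Measure.prod_prod]
  refine ENNReal.mul_pos ?_ (ENNReal.mul_pos ?_ (ENNReal.mul_pos ?_ ?_).ne').ne'
  · rw [Params.clockLaw_singleton]
    simpa using div_pos (π.rate_pos hd hv hb c) (π.totalRate_pos hd hv hb hK)
  all_goals exact (uniformOfFintype_toMeasure_singleton_pos _).ne'

/-- The first mark is independent of the later rings, which have the law of the whole sequence. -/
lemma Params.prob_head_tail {π : Params} (hd : 0 < π.d) (hv : 0 < π.v) (hb : 0 < π.b)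
    {K : ℕ} (hK : 0 < K) (u : Mark K) {B : Set (Sample K)} (hB : MeasurableSet B) :
    π.prob K {ω | (ω 0).2 = u ∧ (fun n => ω (n + 1)) ∈ B} = π.markLaw K {u} * π.prob K B := by
  have := π.isProbabilityMeasure_markLaw hd hv hb hK
  have := isProbabilityMeasure_expMeasure (π.totalRate_pos hd hv hb hK)
  have h := infinitePi_head_tail ((expMeasure (π.totalRate K)).prod (π.markLaw K))
    (A := Set.univ ×ˢ {u}) (MeasurableSet.univ.prod (measurableSet_singleton u)) hB
  rw [Measure.prod_prod, measure_univ, one_mul] at h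
  unfold Params.prob
  rw [← h]
  congr 1
  ext ω
  simp

lemma Params.isProbabilityMeasure_prob {π : Params} (hd : 0 < π.d) (hv : 0 < π.v) (hb : 0 < π.b)
    {K : ℕ} (hK : 0 < K) : IsProbabilityMeasure (π.prob K) := by
  have := π.isProbabilityMeasure_markLaw hd hv hb hK
  have := isProbabilityMeasure_expMeasure (π.totalRate_pos hd hv hb hK)
  unfold Params.prob
  infer_instance

/-! ### The Markov property of the chain -/

variable {m K : ℕ}

lemma chain_succ' (π : Params) (σ : Config m K) (ω : Sample K) (n : ℕ) :
    chain π σ ω (n + 1) = chain π (σ.update π (ω 0).2) (fun k => ω (k + 1)) n := by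
  induction n with
  | zero => rfl
  | succ n ih => rw [chain, ih, chain]

/-- The chain depends on the sample only through finitely many marks, which take finitely many
values, so every set of configurations gives a measurable event. -/
lemma measurableSet_chain_mem (π : Params) (σ : Config m K) (n : ℕ) (S : Set (Config m K)) :
    MeasurableSet {ω : Sample K | chain π σ ω n ∈ S} := by
  induction n generalizing S with
  | zero => simp only [chain, MeasurableSet.const]
  | succ n ih =>
    have h : {ω : Sample K | chain π σ ω (n + 1) ∈ S} =
        ⋃ u : Mark K, {ω | (ω n).2 = u} ∩ {ω | chain π σ ω n ∈ {τ | τ.update π u ∈ S}} := by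
      ext ω
      simp [chain]
    rw [h]
    refine MeasurableSet.iUnion fun u => MeasurableSet.inter ?_ (ih _)
    exact measurableSet_eq_fun (measurable_snd.comp (measurable_pi_apply n)) measurable_const

/-- The event that the particles of the set `I` are alive after each number of rings. -/
def aliveForever (π : Params) (I : Set (Fin K)) (σ : Config m K) : Set (Sample K) :=
  {ω | ∀ n, ∀ i ∈ I, (chain π σ ω n).Alive i}

lemma measurableSet_aliveForever (π : Params) (I : Set (Fin K)) (σ : Config m K) :
    MeasurableSet (aliveForever π I σ) := by
  have h : aliveForever π I σ = ⋂ n, {ω | chain π σ ω n ∈ {τ | ∀ i ∈ I, τ.Alive i}} := by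
    ext ω
    simp [aliveForever]
  rw [h]
  exact MeasurableSet.iInter fun n => measurableSet_chain_mem π σ n _

lemma prob_aliveForever_pos_of_update {π : Params} (hd : 0 < π.d) (hv : 0 < π.v) (hb : 0 < π.b)
    (hK : 0 < K) {I : Set (Fin K)} {σ : Config m K} (hI : ∀ i ∈ I, σ.Alive i) (u : Mark K)
    (h : 0 < π.prob K (aliveForever π I (σ.update π u))) :
    0 < π.prob K (aliveForever π I σ) := by
  have h1 := π.prob_head_tail hd hv hb hK u (measurableSet_aliveForever π I (σ.update π u))
  have h2 : 0 < π.markLaw K {u} * π.prob K (aliveForever π I (σ.update π u)) :=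
    ENNReal.mul_pos (π.markLaw_singleton_pos hd hv hb hK u).ne' h.ne'
  rw [← h1] at h2
  refine h2.trans_le (measure_mono ?_)
  rintro ω ⟨rfl, hω⟩ n
  cases n with
  | zero => exact hI
  | succ n =>
    intro i hi
    rw [chain_succ']
    exact hω n i hi

/-- A maximal inequality: if `Φ` is a nonnegative function that does not increase in mean while the
particles of `I` are alive, and that is at least `1` when one of them is dead, then the probability
that one of them ever dies is at most the initial value of `Φ`. The invariant `Inv` confines the
chain to the configurations on which these properties are known. -/
lemma prob_aliveForever_pos_of_supermartingale {π : Params} (hd : 0 < π.d) (hv : 0 < π.v)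
    (hb : 0 < π.b) (hK : 0 < K) (I : Set (Fin K)) (Inv : Config m K → Prop)
    (Φ : Config m K → ℝ) (hΦ : ∀ σ, 0 ≤ Φ σ)
    (hInv : ∀ σ, Inv σ → ∀ u, Inv (σ.update π u))
    (hdead : ∀ σ, Inv σ → (∃ i ∈ I, ¬ σ.Alive i) → 1 ≤ Φ σ)
    (hmean : ∀ σ, Inv σ → (∀ i ∈ I, σ.Alive i) →
      ∫ u, Φ (σ.update π u) ∂(π.markLaw K) ≤ Φ σ)
    (σ : Config m K) (hσ : Inv σ) (hlt : Φ σ < 1) :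
    0 < π.prob K (aliveForever π I σ) := by
  have := π.isProbabilityMeasure_markLaw hd hv hb hK
  have := π.isProbabilityMeasure_prob hd hv hb hK
  set D : Config m K → ℕ → Set (Sample K) := fun σ n =>
    {ω | ∃ k ≤ n, ∃ i ∈ I, ¬ (chain π σ ω k).Alive i} with hD
  have hDm : ∀ σ n, MeasurableSet (D σ n) := fun σ n => by
    have h : D σ n = ⋃ k, ⋃ _ : k ≤ n, {ω | chain π σ ω k ∈ {τ | ∃ i ∈ I, ¬ τ.Alive i}} := by
      ext ω
      simp [hD]
    rw [h]
    exact MeasurableSet.iUnion fun k => MeasurableSet.iUnion fun _ =>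
      measurableSet_chain_mem π σ k _
  have key : ∀ n σ, Inv σ → π.prob K (D σ n) ≤ ENNReal.ofReal (Φ σ) := by
    intro n
    induction n with
    | zero =>
      intro σ hσ
      by_cases h : ∃ i ∈ I, ¬ σ.Alive i
      · exact prob_le_one.trans (by simpa using hdead σ hσ h)
      · have : D σ 0 = ∅ := by
          ext ω
          simpa [hD, chain] using h
        simp [this]
    | succ n ih =>
      intro σ hσ
      by_cases h : ∃ i ∈ I, ¬ σ.Alive i
      · exact prob_le_one.trans (by simpa using hdead σ hσ h)
      have halive : ∀ i ∈ I, σ.Alive i := by simpa using h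
      -- No particle of `I` is dead at the start, so the first death follows the first ring.
      have hsub : D σ (n + 1) ⊆ ⋃ u : Mark K,
          {ω | (ω 0).2 = u ∧ (fun n => ω (n + 1)) ∈ D (σ.update π u) n} := by
        rintro ω ⟨k, hk, i, hi, hdead⟩
        cases k with
        | zero => exact absurd (halive i hi) hdead
        | succ k =>
          rw [chain_succ'] at hdead
          exact Set.mem_iUnion.2 ⟨_, rfl, k, by omega, i, hi, hdead⟩
      calc π.prob K (D σ (n + 1))
          ≤ ∑ u : Mark K, π.prob K
              {ω | (ω 0).2 = u ∧ (fun n => ω (n + 1)) ∈ D (σ.update π u) n} :=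
            (measure_mono hsub).trans (measure_iUnion_fintype_le _ _)
        _ = ∑ u : Mark K, π.markLaw K {u} * π.prob K (D (σ.update π u) n) :=
            Finset.sum_congr rfl fun u _ => π.prob_head_tail hd hv hb hK u (hDm _ _)
        _ ≤ ∑ u : Mark K, ENNReal.ofReal (Φ (σ.update π u)) * π.markLaw K {u} :=
            Finset.sum_le_sum fun u _ => by
              rw [mul_comm]
              exact mul_le_mul_left (ih _ (hInv σ hσ u)) _
        _ = ∫⁻ u, ENNReal.ofReal (Φ (σ.update π u)) ∂(π.markLaw K) := (lintegral_fintype _).symm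
        _ = ENNReal.ofReal (∫ u, Φ (σ.update π u) ∂(π.markLaw K)) :=
            (ofReal_integral_eq_lintegral_ofReal Integrable.of_finite
              (ae_of_all _ fun u => hΦ _)).symm
        _ ≤ ENNReal.ofReal (Φ σ) := ENNReal.ofReal_le_ofReal (hmean σ hσ halive)
  have hmono : Monotone (D σ) := fun a b hab ω ⟨k, hk, h⟩ => ⟨k, hk.trans hab, h⟩
  have hU : π.prob K (⋃ n, D σ n) < 1 := by
    rw [hmono.measure_iUnion]
    exact (iSup_le fun n => key n σ hσ).trans_lt (by simpa using hlt)
  have hcompl : aliveForever π I σ = (⋃ n, D σ n)ᶜ := by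
    ext ω
    simp only [aliveForever, hD, Set.mem_ofPred_eq, Set.mem_compl_iff, Set.mem_iUnion, not_exists,
      not_and, not_not]
    exact ⟨fun h n k _ i hi => h k i hi, fun h n i hi => h n n le_rfl i hi⟩
  rw [hcompl, prob_compl_eq_one_sub (MeasurableSet.iUnion fun n => hDm σ n)]
  exact tsub_pos_of_lt hU

/-- Only the sequence of configurations matters for survival: the particles alive in `σ` never die
when they are alive after each number of rings. -/
lemma aliveForever_subset_neverDie (π : Params) (σ : Config m K) :
    aliveForever π {i | σ.Alive i} σ ⊆ neverDie π σ :=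
  fun _ h i hi _ => h _ i hi

/-! ### Configurations reachable without a death -/

/-- `τ` can be reached from `σ` by finitely many rings, none of which kills a particle. -/
def Reachable (π : Params) : Config m K → Config m K → Prop :=
  Relation.ReflTransGen fun σ τ => (∀ i, σ.Alive i → τ.Alive i) ∧ ∃ u, σ.update π u = τ

lemma Reachable.trans {π : Params} {σ τ ρ : Config m K} (h : Reachable π σ τ)
    (h' : Reachable π τ ρ) : Reachable π σ ρ :=
  Relation.ReflTransGen.trans h h'

lemma Reachable.alive {π : Params} {σ τ : Config m K} (h : Reachable π σ τ) {i : Fin K}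
    (hi : σ.Alive i) : τ.Alive i := by
  induction h with
  | refl => exact hi
  | tail _ h ih => exact h.1 i ih

lemma Config.Z_update {π : Params} {σ : Config m K} (u : Mark K) {i : Fin K}
    (hi : σ.Z i ≠ Strategy.unborn) : (σ.update π u).Z i = σ.Z i := by
  obtain ⟨c, e, x, s⟩ := u
  cases c with
  | move k => rfl
  | game p =>
    simp only [Config.update, Config.game]
    split_ifs <;> rfl
  | birth k =>
    simp only [Config.update, Config.birth]
    split_ifs with h
    · refine Function.update_of_ne ?_ _ _
      rintro rfl
      have := (s ⟨σ.freeSlots, h.2.2⟩).2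
      simp only [Config.freeSlots, Finset.mem_filter] at this
      exact hi this.2
    · rfl

lemma Reachable.Z_eq {π : Params} {σ τ : Config m K} (h : Reachable π σ τ) {i : Fin K}
    (hi : σ.Z i ≠ Strategy.unborn) : τ.Z i = σ.Z i := by
  induction h with
  | refl => rfl
  | tail _ h ih =>
    obtain ⟨u, rfl⟩ := h.2
    rw [Config.Z_update u (by rwa [ih]), ih]

lemma Reachable.prob_aliveForever_pos {π : Params} (hd : 0 < π.d) (hv : 0 < π.v) (hb : 0 < π.b)
    (hK : 0 < K) {I : Set (Fin K)} {σ τ : Config m K} (h : Reachable π σ τ)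
    (hI : ∀ i ∈ I, σ.Alive i) (hτ : 0 < π.prob K (aliveForever π I τ)) :
    0 < π.prob K (aliveForever π I σ) := by
  induction h using Relation.ReflTransGen.head_induction_on with
  | refl => exact hτ
  | head h _ ih =>
    obtain ⟨hal, u, rfl⟩ := h
    exact prob_aliveForever_pos_of_update hd hv hb hK hI u (ih fun i hi => hal i (hI i hi))

lemma reachable_add_nsmul_step (π : Params) (σ : Config m K) (i : Fin K) (e : Direction) (n : ℕ)
    (y : ZMod m × ZMod m) :
    Reachable π { σ with X := Function.update σ.X i y }
      { σ with X := Function.update σ.X i (y + n • e.step) } := by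
  induction n with
  | zero =>
    rw [zero_smul, add_zero]
    exact Relation.ReflTransGen.refl
  | succ n ih =>
    refine ih.tail ⟨fun k hk => hk, (Clock.move i, e, true, Classical.arbitrary _), ?_⟩
    simp [Config.update, Config.move, add_smul, add_assoc]

lemma reachable_position [NeZero m] (π : Params) (σ : Config m K) (i : Fin K)
    (x : ZMod m × ZMod m) : Reachable π σ { σ with X := Function.update σ.X i x } := by
  have h1 := reachable_add_nsmul_step π σ i Direction.right (x.1 - (σ.X i).1).val (σ.X i)
  have h2 := reachable_add_nsmul_step π σ i Direction.top (x.2 - (σ.X i).2).val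
    (σ.X i + (x.1 - (σ.X i).1).val • Direction.right.step)
  have hx : σ.X i + (x.1 - (σ.X i).1).val • Direction.right.step +
      (x.2 - (σ.X i).2).val • Direction.top.step = x := by
    ext <;> simp [Direction.step]
  have h := h1.trans h2
  rwa [Function.update_eq_self, hx] at h

lemma reachable_game {π : Params} {σ : Config m K} {i j : Fin K} (hij : i ≠ j)
    (hX : σ.X i = σ.X j) (hi : σ.Alive i) (hj : σ.Alive j)
    (hZ : σ.Z i = Strategy.cooperate ∨ σ.Z j = Strategy.cooperate) {p q : ℝ}
    (hpay : π.payoff true (σ.Z i) (σ.Z j) = (p, q))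
    (hp : 0 < σ.Y i + p) (hq : 0 < σ.Y j + q) :
    Reachable π σ
      { σ with Y := Function.update (Function.update σ.Y i (σ.Y i + p)) j (σ.Y j + q) } := by
  refine Relation.ReflTransGen.single ⟨?_, ?_⟩
  · intro k hk
    refine ⟨hk.1, ?_⟩
    rcases eq_or_ne k j with rfl | hkj
    · simpa using hq
    rcases eq_or_ne k i with rfl | hki
    · simpa [hkj] using hp
    · simpa [hkj, hki] using hk.2
  rcases hij.lt_or_gt with h | h
  · refine ⟨(Clock.game ⟨(i, j), h⟩, Direction.top, true, Classical.arbitrary _), ?_⟩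
    simp only [Config.update, Config.game, if_pos (And.intro hX (And.intro hi hj)), hpay]
  · refine ⟨(Clock.game ⟨(j, i), h⟩, Direction.top, true, Classical.arbitrary _), ?_⟩
    -- A payoff involving a cooperator does not depend on the order of the two players.
    have hpay' : π.payoff true (σ.Z j) (σ.Z i) = (q, p) := by
      revert hpay hZ
      generalize σ.Z i = zi
      generalize σ.Z j = zj
      cases zi <;> cases zj <;> simp +contextual [Params.payoff]
    simp only [Config.update, Config.game, if_pos (And.intro hX.symm (And.intro hj hi)), hpay']
    rw [Function.update_comm hij]

/-- Two particles can be brought together and made to play `n` times in a row, provided that both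
can afford it. -/
lemma reachable_games [NeZero m] {π : Params} {σ : Config m K} {i j : Fin K} (hij : i ≠ j)
    (hi : σ.Alive i) (hj : σ.Alive j)
    (hZ : σ.Z i = Strategy.cooperate ∨ σ.Z j = Strategy.cooperate) {p q : ℝ}
    (hpay : π.payoff true (σ.Z i) (σ.Z j) = (p, q)) (n : ℕ)
    (hp : 0 < σ.Y i + n * p) (hq : 0 < σ.Y j + n * q) :
    ∃ τ, Reachable π σ τ ∧ τ.Z = σ.Z ∧
      τ.Y = Function.update (Function.update σ.Y i (σ.Y i + n * p)) j (σ.Y j + n * q) := by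
  -- The wealths stay positive along the way because they vary monotonically.
  have pos : ∀ {y r : ℝ} {k l : ℕ}, 0 < y → 0 < y + l * r → k ≤ l → 0 < y + k * r := by
    intro y r k l hy hl hkl
    have h : (k : ℝ) ≤ l := by exact_mod_cast hkl
    rcases le_total 0 r with hr | hr
    · positivity
    · nlinarith [mul_nonneg (sub_nonneg.2 h) (neg_nonneg.2 hr)]
  refine ⟨⟨Function.update σ.X i (σ.X j), _, σ.Z⟩, ?_, rfl, rfl⟩
  have key : ∀ k ≤ n, Reachable π σ ⟨Function.update σ.X i (σ.X j),
      Function.update (Function.update σ.Y i (σ.Y i + k * p)) j (σ.Y j + k * q), σ.Z⟩ := by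
    intro k
    induction k with
    | zero =>
      intro _
      convert reachable_position π σ i (σ.X j) using 2
      simp
    | succ k ih =>
      intro hk
      have hp' := pos hi.2 hp (Nat.le_of_succ_le hk)
      have hq' := pos hj.2 hq (Nat.le_of_succ_le hk)
      have hp'' := pos hi.2 hp hk
      have hq'' := pos hj.2 hq hk
      push_cast at hp'' hq''
      have hg := reachable_game (π := π) (p := p) (q := q)
        (σ := ⟨Function.update σ.X i (σ.X j),
          Function.update (Function.update σ.Y i (σ.Y i + k * p)) j (σ.Y j + k * q), σ.Z⟩)
        hij (by simp [hij.symm]) ⟨hi.1, by simpa [hij] using hp'⟩ ⟨hj.1, by simpa using hq'⟩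
        hZ hpay
        (by simp only [Function.update_of_ne hij, Function.update_self]; linarith)
        (by simp only [Function.update_self]; linarith)
      convert (ih (Nat.le_of_succ_le hk)).trans hg using 2
      ext r
      rcases eq_or_ne r j with rfl | hrj
      · simp only [Function.update_self]
        push_cast
        ring
      rcases eq_or_ne r i with rfl | hri
      · simp only [Function.update_of_ne hij, Function.update_self]
        push_cast
        ring
      · simp only [Function.update_of_ne hrj, Function.update_of_ne hri]
  exact key n le_rfl

/-- Besides any given particle, some other cooperator is alive. -/
def HasPartners (σ : Config m K) : Prop :=
  ∀ i, ∃ j, j ≠ i ∧ σ.Alive j ∧ σ.Z j = Strategy.cooperate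

lemma Config.TwoCooperatorsOneDefector.hasPartners {σ : Config m K}
    (h : σ.TwoCooperatorsOneDefector) : HasPartners σ := by
  intro i
  obtain ⟨j, hj, hne⟩ := Set.exists_ne_of_one_lt_ncard (lt_of_lt_of_le one_lt_two h.1) i
  exact ⟨j, hne, hj⟩

lemma Reachable.hasPartners {π : Params} {σ τ : Config m K} (h : Reachable π σ τ)
    (hσ : HasPartners σ) : HasPartners τ := by
  intro i
  obtain ⟨j, hji, hj, hZ⟩ := hσ i
  exact ⟨j, hji, h.alive hj, by rw [h.Z_eq hj.1, hZ]⟩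

/-- Any living particle can be made arbitrarily rich, at no net cost to the others: a cooperator
plays with another cooperator, a defector with a cooperator that was first made rich enough. -/
lemma exists_reachable_wealth [NeZero m] {π : Params} (hR : 0 < π.R) (hT : 0 < π.T)
    {σ : Config m K} (hσ : HasPartners σ) {i : Fin K} (hi : σ.Alive i) (M : ℝ) :
    ∃ τ, Reachable π σ τ ∧ τ.Z = σ.Z ∧ (∀ k, σ.Y k ≤ τ.Y k) ∧
      (∀ k, ¬ σ.Alive k → τ.Y k = σ.Y k) ∧ M ≤ τ.Y i := by
  have coop : ∀ {i : Fin K}, σ.Alive i → σ.Z i = Strategy.cooperate → ∀ M : ℝ,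
      ∃ τ, Reachable π σ τ ∧ τ.Z = σ.Z ∧ (∀ k, σ.Y k ≤ τ.Y k) ∧
      (∀ k, ¬ σ.Alive k → τ.Y k = σ.Y k) ∧ M ≤ τ.Y i := by
    intro i hi hZi M
    obtain ⟨j, hji, hj, hZj⟩ := hσ i
    obtain ⟨n, hn⟩ := exists_nat_ge ((M - σ.Y i) / π.R)
    rw [div_le_iff₀ hR] at hn
    have hnR : 0 ≤ n * π.R := by positivity
    obtain ⟨τ, hτ, hZ, hY⟩ := reachable_games (π := π) (p := π.R) (q := π.R) hji.symm hi hj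
      (Or.inl hZi) (by rw [hZi, hZj, Params.payoff]) n (by linarith [hi.2]) (by linarith [hj.2])
    refine ⟨τ, hτ, hZ, fun k => ?_, fun k hk => ?_, ?_⟩
    · rw [hY]
      rcases eq_or_ne k j with rfl | hkj
      · simpa using hnR
      rcases eq_or_ne k i with rfl | hki
      · simpa [hkj] using hnR
      · simp [hkj, hki]
    · have hkj : k ≠ j := by rintro rfl; exact hk hj
      have hki : k ≠ i := by rintro rfl; exact hk hi
      simp [hY, hkj, hki]
    · rw [hY, Function.update_of_ne hji.symm, Function.update_self]
      linarith
  rcases hZi : σ.Z i with _ | _ | _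
  · exact absurd hZi hi.1
  · exact coop hi hZi M
  · obtain ⟨c, hci, hc, hZc⟩ := hσ i
    obtain ⟨n, hn⟩ := exists_nat_ge ((M - σ.Y i) / π.T)
    rw [div_le_iff₀ hT] at hn
    have hnT : 0 ≤ n * π.T := by positivity
    obtain ⟨τ, hτ, hZ, hle, hdead, hM⟩ := coop hc hZc (σ.Y c + n * π.S)
    have hτi := hτ.alive hi
    obtain ⟨ρ, hρ, hZ', hY'⟩ := reachable_games (π := π) (p := π.T) (q := -π.S) hci.symm hτi
      (hτ.alive hc) (Or.inr (by rw [hZ, hZc])) (by rw [hZ, hZi, hZc, Params.payoff]) n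
      (by linarith [hτi.2]) (by linarith [hc.2])
    refine ⟨ρ, hτ.trans hρ, hZ'.trans hZ, fun k => ?_, fun k hk => ?_, ?_⟩
    · rw [hY']
      rcases eq_or_ne k c with rfl | hkc
      · rw [Function.update_self]
        linarith
      rcases eq_or_ne k i with rfl | hki
      · rw [Function.update_of_ne hkc, Function.update_self]
        linarith [hle k]
      · simpa [hkc, hki] using hle k
    · have hkc : k ≠ c := by rintro rfl; exact hk hc
      have hki : k ≠ i := by rintro rfl; exact hk hi
      simpa [hY', hkc, hki] using hdead k hk
    · rw [hY', Function.update_of_ne hci.symm, Function.update_self]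
      linarith [hle i]

/-- All living particles can be made arbitrarily rich together. -/
lemma exists_reachable_wealth_forall [NeZero m] {π : Params} (hR : 0 < π.R) (hT : 0 < π.T)
    {σ : Config m K} (hσ : HasPartners σ) (M : Fin K → ℝ) :
    ∃ τ, Reachable π σ τ ∧ τ.Z = σ.Z ∧ (∀ k, ¬ σ.Alive k → τ.Y k = σ.Y k) ∧
      ∀ i, σ.Alive i → M i ≤ τ.Y i := by
  classical
  have key : ∀ s : Finset (Fin K), ∃ τ, Reachable π σ τ ∧ τ.Z = σ.Z ∧
      (∀ k, ¬ σ.Alive k → τ.Y k = σ.Y k) ∧ ∀ i ∈ s, σ.Alive i → M i ≤ τ.Y i := by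
    intro s
    induction s using Finset.induction_on with
    | empty => exact ⟨σ, Relation.ReflTransGen.refl, rfl, fun _ _ => rfl, by simp⟩
    | insert i s _ ih =>
      obtain ⟨τ, hτ, hZ, hdead, hM⟩ := ih
      by_cases hi : σ.Alive i
      · obtain ⟨ρ, hρ, hZ', hle, hdead', hM'⟩ :=
          exists_reachable_wealth hR hT (hτ.hasPartners hσ) (hτ.alive hi) (M i)
        refine ⟨ρ, hτ.trans hρ, hZ'.trans hZ, fun k hk => ?_, fun k hk hkσ => ?_⟩
        · rw [hdead' k, hdead k hk]
          rintro ⟨h1, h2⟩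
          rw [hZ] at h1
          rw [hdead k hk] at h2
          exact hk ⟨h1, h2⟩
        · rcases Finset.mem_insert.1 hk with rfl | hk
          · exact hM'
          · exact (hM k hk hkσ).trans (hle k)
      · refine ⟨τ, hτ, hZ, hdead, fun k hk hkσ => ?_⟩
        rcases Finset.mem_insert.1 hk with rfl | hk
        · exact absurd hkσ hi
        · exact hM k hk hkσ
  obtain ⟨τ, h1, h2, h3, h4⟩ := key Finset.univ
  exact ⟨τ, h1, h2, h3, fun i => h4 i (Finset.mem_univ i)⟩

/-- A cooperator that is made rich again and again can fill all free slots with its offspring. -/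
lemma exists_reachable_all_born [NeZero m] {π : Params} (hR : 0 < π.R) (hT : 0 < π.T)
    (hw_c : π.w_0 < π.w_c) {σ : Config m K} (hσ : HasPartners σ) :
    ∃ τ, Reachable π σ τ ∧ ∀ i, τ.Z i ≠ Strategy.unborn := by
  induction hn : σ.freeSlots.card using Nat.strong_induction_on generalizing σ with
  | _ n ih =>
    subst hn
    rcases σ.freeSlots.eq_empty_or_nonempty with he | hne
    · refine ⟨σ, Relation.ReflTransGen.refl, fun i hi => ?_⟩
      have : i ∈ σ.freeSlots := by simp [Config.freeSlots, hi]
      simp [he] at this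
    · obtain ⟨c, -, hc, -⟩ := hσ hne.choose
      obtain ⟨τ, hτ, hZ, -, -, hM⟩ := exists_reachable_wealth hR hT hσ hc (π.w_c + 1)
      have hτc := hτ.alive hc
      have hfree : τ.freeSlots = σ.freeSlots := by simp [Config.freeSlots, hZ]
      have hcond : τ.Z c ≠ Strategy.unborn ∧ π.w_c < τ.Y c ∧ τ.freeSlots.Nonempty :=
        ⟨hτc.1, by linarith, by rwa [hfree]⟩
      let s : SlotChoice K := Classical.arbitrary _
      set j : Fin K := (s ⟨τ.freeSlots, hcond.2.2⟩).1 with hj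
      have hjfree : j ∈ τ.freeSlots := (s ⟨τ.freeSlots, hcond.2.2⟩).2
      have hZj : τ.Z j = Strategy.unborn := by simpa [Config.freeSlots] using hjfree
      have hbirth : τ.update π (Clock.birth c, Direction.top, true, s) =
          { X := Function.update τ.X j (τ.X c)
            Y := Function.update (Function.update τ.Y c (τ.Y c - π.w_0)) j π.w_0
            Z := Function.update τ.Z j (τ.Z c) } := by
        simp only [Config.update, Config.birth, dif_pos hcond]
        rfl
      have hρ : Reachable π τ (τ.update π (Clock.birth c, Direction.top, true, s)) := by
        refine Relation.ReflTransGen.single ⟨fun k hk => ?_, _, rfl⟩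
        have hkj : k ≠ j := by rintro rfl; exact hk.1 hZj
        rw [hbirth]
        refine ⟨by simpa [hkj] using hk.1, ?_⟩
        rcases eq_or_ne k c with rfl | hkc
        · simp only [Function.update_of_ne hkj, Function.update_self]
          linarith
        · simpa [hkj, hkc] using hk.2
      have hlt : (τ.update π (Clock.birth c, Direction.top, true, s)).freeSlots.card <
          σ.freeSlots.card := by
        rw [← hfree]
        refine Finset.card_lt_card ((Finset.ssubset_iff_of_subset fun k hk => ?_).2
          ⟨j, hjfree, ?_⟩)
        · by_contra hk'
          have hkZ : τ.Z k ≠ Strategy.unborn := by simpa [Config.freeSlots] using hk'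
          have := Config.Z_update (π := π) (Clock.birth c, Direction.top, true, s) hkZ
          simp only [Config.freeSlots, Finset.mem_filter, Finset.mem_univ, true_and] at hk
          exact hkZ (this ▸ hk)
        · rw [hbirth]
          simpa [Config.freeSlots] using hτc.1
      obtain ⟨ρ, h1, h2⟩ := ih _ hlt ((hτ.trans hρ).hasPartners hσ) rfl
      exact ⟨ρ, (hτ.trans hρ).trans h1, h2⟩

/-! ### A potential on the torus -/

/-- A function on the torus that favours the origin so strongly that it increases in mean under a
step of the walk from any other site: some neighbour of the site is nearer to the origin (as measured
by the sum of the two representatives in `[0, m)`), and there the potential is `8` times larger. -/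
def potential (x : ZMod m × ZMod m) : ℝ := 8 ^ (2 * m - (x.1.val + x.2.val))

lemma one_le_potential (x : ZMod m × ZMod m) : 1 ≤ potential x :=
  one_le_pow₀ (by norm_num)

lemma potential_le (x : ZMod m × ZMod m) : potential x ≤ 8 ^ (2 * m) :=
  pow_le_pow_right₀ (by norm_num) (Nat.sub_le _ _)

lemma abs_potential_sub_le (x y : ZMod m × ZMod m) :
    |potential x - potential y| ≤ 8 ^ (2 * m) := by
  rw [abs_le]
  constructor <;>
    linarith [one_le_potential x, one_le_potential y, potential_le x, potential_le y]

lemma val_sub_one_add_one [NeZero m] {a : ZMod m} (ha : a ≠ 0) : (a - 1).val + 1 = a.val := by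
  have h1 : 1 < m := by
    by_contra h
    have hm1 : m = 1 := le_antisymm (not_lt.1 h) (Nat.pos_of_neZero m)
    subst hm1
    exact ha (Subsingleton.elim _ _)
  have : Fact (1 < m) := ⟨h1⟩
  have hpos : 0 < a.val := Nat.pos_of_ne_zero (by simpa using ha)
  rw [ZMod.val_sub (by rw [ZMod.val_one]; exact hpos), ZMod.val_one]
  omega

lemma exists_potential_add_step [NeZero m] {x : ZMod m × ZMod m} (hx : x ≠ 0) :
    ∃ e : Direction, potential (x + e.step) = 8 * potential x := by
  have h1 := ZMod.val_lt x.1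
  have h2 := ZMod.val_lt x.2
  by_cases h : x.1 = 0
  · have h' : x.2 ≠ 0 := fun h' => hx (Prod.ext h h')
    refine ⟨Direction.bottom, ?_⟩
    have hv := val_sub_one_add_one h'
    simp only [potential, Direction.step, Prod.fst_add, Prod.snd_add, add_zero, ← sub_eq_add_neg]
    rw [← pow_succ']
    congr 1
    omega
  · refine ⟨Direction.left, ?_⟩
    have hv := val_sub_one_add_one h
    simp only [potential, Direction.step, Prod.fst_add, Prod.snd_add, add_zero, ← sub_eq_add_neg]
    rw [← pow_succ']
    congr 1
    omega

/-- The mean of a function of a uniform direction. -/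
noncomputable def dirMean (f : Direction → ℝ) : ℝ :=
  (f Direction.top + f Direction.bottom + f Direction.left + f Direction.right) / 4

/-- The mean variation of the potential in a step of the walk from `x`. -/
noncomputable def potentialDrift (x : ZMod m × ZMod m) : ℝ :=
  dirMean fun e => potential (x + e.step) - potential x

lemma dirMean_sub_step (x : ZMod m × ZMod m) :
    dirMean (fun e => potential (x - e.step) - potential x) = potentialDrift x := by
  simp only [potentialDrift, dirMean, Direction.step, sub_eq_add_neg x, Prod.neg_mk, neg_neg,
    neg_zero]
  ring

lemma one_le_potentialDrift [NeZero m] {x : ZMod m × ZMod m} (hx : x ≠ 0) :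
    1 ≤ potentialDrift x := by
  obtain ⟨e, he⟩ := exists_potential_add_step hx
  have h := fun e : Direction => one_le_potential (x + e.step)
  have ht := h Direction.top
  have hb := h Direction.bottom
  have hl := h Direction.left
  have hr := h Direction.right
  have hx1 := one_le_potential x
  simp only [potentialDrift, dirMean]
  cases e <;> linarith

lemma neg_le_potentialDrift (x : ZMod m × ZMod m) : -8 ^ (2 * m) ≤ potentialDrift x := by
  have h := fun e : Direction => (abs_le.1 (abs_potential_sub_le (x + e.step) x)).1
  have ht := h Direction.top
  have hb := h Direction.bottom
  have hl := h Direction.left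
  have hr := h Direction.right
  simp only [potentialDrift, dirMean]
  linarith

/-! ### Means with respect to the law of a mark -/

lemma integral_uniform_direction (f : Direction → ℝ) :
    ∫ e, f e ∂(PMF.uniformOfFintype Direction).toMeasure = dirMean f := by
  rw [PMF.integral_eq_sum]
  have hc : Fintype.card Direction = 4 := rfl
  simp only [PMF.uniformOfFintype_apply, hc]
  change ∑ e ∈ {Direction.top, Direction.bottom, Direction.left, Direction.right}, _ = _
  simp [dirMean]
  ring

lemma sum_clock (f : Clock K → ℝ) :
    ∑ c, f c = ∑ i, f (Clock.move i) + ∑ p, f (Clock.game p) + ∑ i, f (Clock.birth i) := by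
  let e : Fin K ⊕ {p : Fin K × Fin K // p.1 < p.2} ⊕ Fin K ≃ Clock K :=
    { toFun := fun s => match s with
        | Sum.inl i => Clock.move i
        | Sum.inr (Sum.inl p) => Clock.game p
        | Sum.inr (Sum.inr i) => Clock.birth i
      invFun := fun c => match c with
        | Clock.move i => Sum.inl i
        | Clock.game p => Sum.inr (Sum.inl p)
        | Clock.birth i => Sum.inr (Sum.inr i)
      left_inv := by rintro (i | p | i) <;> rfl
      right_inv := by rintro (i | p | i) <;> rfl }
  rw [← Equiv.sum_comp e, Fintype.sum_sum_type, Fintype.sum_sum_type, ← add_assoc]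
  rfl

lemma Params.integral_markLaw {π : Params} (hd : 0 < π.d) (hv : 0 < π.v) (hb : 0 < π.b)
    (hK : 0 < K) (f : Clock K → Direction → ℝ) :
    ∫ u, f u.1 u.2.1 ∂(π.markLaw K) =
      (π.d * ∑ i, dirMean (f (Clock.move i)) + π.v * ∑ p, dirMean (f (Clock.game p)) +
        π.b * ∑ i, dirMean (f (Clock.birth i))) / π.totalRate K := by
  have := π.isProbabilityMeasure_clockLaw hd hv hb hK
  unfold Params.markLaw
  rw [integral_prod _ Integrable.of_finite]
  have h : ∀ c : Clock K, ∫ z : Direction × Bool × SlotChoice K, f c z.1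
      ∂((PMF.uniformOfFintype Direction).toMeasure.prod
        ((PMF.uniformOfFintype Bool).toMeasure.prod
          (PMF.uniformOfFintype (SlotChoice K)).toMeasure)) = dirMean (f c) := fun c => by
    rw [integral_fun_fst, probReal_univ, one_smul, integral_uniform_direction]
  simp only [h]
  rw [integral_fintype Integrable.of_finite, sum_clock]
  have hc : ∀ c : Clock K, (π.clockLaw K).real {c} = π.rate c / π.totalRate K := fun c => by
    rw [Measure.real, Params.clockLaw_singleton, ENNReal.toReal_ofReal
      (div_pos (π.rate_pos hd hv hb c) (π.totalRate_pos hd hv hb hK)).le]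
  simp only [hc, Params.rate, smul_eq_mul, ← Finset.mul_sum]
  ring

lemma card_pairs_mem_le (i : Fin K) :
    (Finset.univ.filter fun p : {p : Fin K × Fin K // p.1 < p.2} =>
      p.1.1 = i ∨ p.1.2 = i).card ≤ K := by
  -- A pair containing `i` is determined by its other element.
  calc _ ≤ (Finset.univ : Finset (Fin K)).card :=
        Finset.card_le_card_of_injOn (fun p => if p.1.1 = i then p.1.2 else p.1.1)
          (fun _ _ => Finset.mem_coe.2 (Finset.mem_univ _)) ?_
    _ = K := Finset.card_fin K
  rintro ⟨⟨a, b⟩, hab⟩ h1 ⟨⟨a', b'⟩, hab'⟩ h2 h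
  simp only [Finset.coe_filter, Finset.mem_univ, true_and, Set.mem_ofPred_eq] at h1 h2
  simp only at h hab hab'
  simp only [Subtype.mk.injEq, Prod.mk.injEq]
  split_ifs at h <;> constructor <;> omega

/-! ### The exponential supermartingale of a particle -/

/-- The wealth of `i`, corrected by a multiple of the potential of the displacement from `c` to
`i`. -/
noncomputable def correctedWealth (a : ℝ) (i c : Fin K) (σ : Config m K) : ℝ :=
  σ.Y i + a * potential (σ.X i - σ.X c)

open Classical in
/-- A lower bound for the variation of the corrected wealth of `i` when a clock rings: `x` is the
displacement from `c` to `i`, which a game between the two requires to be `0`, `g` is the gain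
in this game, and `l` is the most that `i` can lose in a game. The loss `l` is charged to every game
of `i`, even the one with `c`; this only weakens the bound. -/
noncomputable def increment (a g l : ℝ) (i c : Fin K) (x : ZMod m × ZMod m) :
    Clock K → Direction → ℝ
  | Clock.move k, e =>
      (if k = i then a * (potential (x + e.step) - potential x) else 0) +
        (if k = c then a * (potential (x - e.step) - potential x) else 0)
  | Clock.game p, _ =>
      (if (p.1 = (i, c) ∨ p.1 = (c, i)) ∧ x = 0 then g else 0) -
        (if p.1.1 = i ∨ p.1.2 = i then l else 0)
  | Clock.birth _, _ => 0

/-- The hypotheses on the payoffs of a particle `i` of behaviour `z` and of its partner of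
behaviour `z'`: the particle gains at least `g` in a game with its partner and never loses more
than `l`. -/
structure PayoffBounds (π : Params) (z z' : Strategy) (g l : ℝ) : Prop where
  gain_fst : ∀ coin, g ≤ (π.payoff coin z z').1
  gain_snd : ∀ coin, g ≤ (π.payoff coin z' z).2
  loss_fst : ∀ coin y, -l ≤ (π.payoff coin z y).1
  loss_snd : ∀ coin y, -l ≤ (π.payoff coin y z).2

lemma correctedWealth_add_increment_le {π : Params} {a g l : ℝ} {i c : Fin K} (hic : i ≠ c)
    (hl : 0 ≤ l) {σ : Config m K} (hborn : ∀ k, σ.Z k ≠ Strategy.unborn)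
    (hi : σ.Alive i) (hc : σ.Alive c) (hpay : PayoffBounds π (σ.Z i) (σ.Z c) g l)
    (u : Mark K) :
    correctedWealth a i c σ + increment a g l i c (σ.X i - σ.X c) u.1 u.2.1 ≤
      correctedWealth a i c (σ.update π u) := by
  obtain ⟨k, e, x, s⟩ := u
  cases k with
  | move k =>
    simp only [Config.update, Config.move, increment, correctedWealth]
    rcases eq_or_ne k i with rfl | hki
    · have h : σ.X k + e.step - σ.X c = σ.X k - σ.X c + e.step := by abel
      simp only [Function.update_self, Function.update_of_ne hic.symm, if_pos, if_neg hic, h]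
      linarith
    rcases eq_or_ne k c with rfl | hkc
    · have h : σ.X i - (σ.X k + e.step) = σ.X i - σ.X k - e.step := by abel
      simp only [Function.update_self, Function.update_of_ne hic, if_pos, if_neg hki, h]
      linarith
    · simp only [Function.update_of_ne hki.symm, Function.update_of_ne hkc.symm, if_neg hki,
        if_neg hkc]
      linarith
  | game p =>
    obtain ⟨⟨k, j⟩, hkj⟩ := p
    have hkj' : k ≠ j := ne_of_lt hkj
    simp only [Config.update, Config.game, increment, correctedWealth, Prod.mk.injEq]
    by_cases hplay : σ.X k = σ.X j ∧ σ.Alive k ∧ σ.Alive j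
    · rw [if_pos hplay]
      rcases eq_or_ne k i with rfl | hki
      · simp only [Function.update_of_ne hkj', Function.update_self]
        rcases eq_or_ne j c with rfl | hjc
        · have := hpay.gain_fst x
          split_ifs <;> first | linarith | simp_all
        · have := hpay.loss_fst x (σ.Z j)
          simp only [true_and, hjc, hic, false_and, or_false, if_false, true_or, if_true]
          linarith
      rcases eq_or_ne j i with rfl | hji
      · simp only [Function.update_self]
        rcases eq_or_ne k c with rfl | hkc
        · have := hpay.gain_snd x
          split_ifs <;> first | linarith | simp_all
        · have := hpay.loss_snd x (σ.Z k)
          simp only [hki, hkc, false_and, or_false, if_false, or_true, if_true]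
          linarith
      · simp only [Function.update_of_ne hki.symm, Function.update_of_ne hji.symm, hki, hji,
          false_and, and_false, or_false, if_false]
        linarith
    · rw [if_neg hplay]
      -- The partners `i` and `c` are alive: they do not play only if they are on distinct sites.
      have h : ¬ ((k = i ∧ j = c ∨ k = c ∧ j = i) ∧ σ.X i - σ.X c = 0) := by
        rintro ⟨⟨rfl, rfl⟩ | ⟨rfl, rfl⟩, h⟩
        · exact hplay ⟨sub_eq_zero.1 h, hi, hc⟩
        · exact hplay ⟨(sub_eq_zero.1 h).symm, hc, hi⟩
      rw [if_neg h]
      split_ifs <;> linarith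
  | birth k =>
    have h : ¬ (σ.Z k ≠ Strategy.unborn ∧ π.w_c < σ.Y k ∧ σ.freeSlots.Nonempty) := by
      rintro ⟨-, -, j, hj⟩
      simp only [Config.freeSlots, Finset.mem_filter] at hj
      exact hborn j hj.2
    simp only [Config.update, Config.birth, dif_neg h, increment, add_zero, le_refl]

lemma abs_increment_le {a g l : ℝ} (ha : 0 ≤ a) (hg : 0 ≤ g) (hl : 0 ≤ l) {i c : Fin K}
    (hic : i ≠ c) (x : ZMod m × ZMod m) (k : Clock K) (e : Direction) :
    |increment a g l i c x k e| ≤ a * 8 ^ (2 * m) + g + l := by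
  have hH : 0 ≤ a * 8 ^ (2 * m) := by positivity
  cases k with
  | move k =>
    have h1 := abs_potential_sub_le (x + e.step) x
    have h2 := abs_potential_sub_le (x - e.step) x
    have h1' : |a * (potential (x + e.step) - potential x)| ≤ a * 8 ^ (2 * m) := by
      rw [abs_mul, abs_of_nonneg ha]; exact mul_le_mul_of_nonneg_left h1 ha
    have h2' : |a * (potential (x - e.step) - potential x)| ≤ a * 8 ^ (2 * m) := by
      rw [abs_mul, abs_of_nonneg ha]; exact mul_le_mul_of_nonneg_left h2 ha
    simp only [increment]
    rcases eq_or_ne k i with rfl | hki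
    · rw [if_pos rfl, if_neg hic, add_zero]; linarith
    · rw [if_neg hki, zero_add]
      split_ifs
      · linarith
      · rw [abs_zero]; linarith
  | game p =>
    simp only [increment]
    rw [abs_le]
    split_ifs <;> constructor <;> linarith
  | birth k => simp only [increment, abs_zero]; linarith

/-- The mean increment is bounded away from `0`, uniformly in the displacement: at the origin thanks
to the gain `g`, and elsewhere thanks to the potential. -/
lemma exists_le_integral_increment [NeZero m] {π : Params} (hd : 0 < π.d) (hv : 0 < π.v)
    (hb : 0 < π.b) (hK : 0 < K) {g l : ℝ} (hl : 0 < l) (hgl : K * (1 + 2 * 8 ^ (2 * m)) * l < g)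
    {i c : Fin K} (hic : i ≠ c) :
    ∃ ε > 0, ∀ x : ZMod m × ZMod m,
      ε ≤ ∫ u, increment (π.v * K * l / π.d) g l i c x u.1 u.2.1 ∂(π.markLaw K) := by
  classical
  have hL := π.totalRate_pos hd hv hb hK
  have hK' : (0 : ℝ) < K := by exact_mod_cast hK
  set a := π.v * K * l / π.d with ha
  have had : π.d * a = π.v * K * l := by rw [ha]; field_simp
  have ha0 : 0 < a := by rw [ha]; positivity
  refine ⟨min (π.v * (g - K * (1 + 2 * 8 ^ (2 * m)) * l)) (π.v * K * l) / π.totalRate K,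
    div_pos (lt_min (mul_pos hv (by linarith)) (by positivity)) hL, fun x => ?_⟩
  rw [Params.integral_markLaw hd hv hb hK]
  refine div_le_div_of_nonneg_right ?_ hL.le
  have hmove : ∀ k : Fin K, dirMean (increment a g l i c x (Clock.move k)) =
      (if k = i then a * potentialDrift x else 0) +
        (if k = c then a * potentialDrift x else 0) := by
    intro k
    have h1 : dirMean (fun e => potential (x + e.step) - potential x) = potentialDrift x := rfl
    have h2 := dirMean_sub_step x
    simp only [dirMean] at h1 h2
    simp only [increment, dirMean]
    split_ifs
    · linear_combination a * h1 + a * h2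
    · linear_combination a * h1
    · linear_combination a * h2
    · ring
  have hsum : ∑ k : Fin K, dirMean (increment a g l i c x (Clock.move k)) =
      2 * (a * potentialDrift x) := by
    simp only [hmove, Finset.sum_add_distrib, Finset.sum_ite_eq', Finset.mem_univ, if_true]
    ring
  have hbirth : ∑ k : Fin K, dirMean (increment a g l i c x (Clock.birth k)) = 0 := by
    simp [increment, dirMean]
  have hg0 : 0 < g := lt_trans (by positivity) hgl
  have hgame : (if x = 0 then g else 0) - K * l ≤
      ∑ p : {p : Fin K × Fin K // p.1 < p.2}, dirMean (increment a g l i c x (Clock.game p)) := by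
    have h1 : ∀ p : {p : Fin K × Fin K // p.1 < p.2},
        dirMean (increment a g l i c x (Clock.game p)) =
          (if (p.1 = (i, c) ∨ p.1 = (c, i)) ∧ x = 0 then g else 0) -
            (if p.1.1 = i ∨ p.1.2 = i then l else 0) := by
      intro p
      simp only [increment, dirMean]
      ring
    simp only [h1, Finset.sum_sub_distrib]
    refine sub_le_sub ?_ ?_
    · obtain ⟨p₀, hp₀⟩ : ∃ p : {p : Fin K × Fin K // p.1 < p.2},
          p.1 = (i, c) ∨ p.1 = (c, i) := by
        rcases hic.lt_or_gt with h | h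
        · exact ⟨⟨(i, c), h⟩, Or.inl rfl⟩
        · exact ⟨⟨(c, i), h⟩, Or.inr rfl⟩
      refine le_trans (le_of_eq ?_) (Finset.single_le_sum (f := fun p :
        {p : Fin K × Fin K // p.1 < p.2} =>
          if (p.1 = (i, c) ∨ p.1 = (c, i)) ∧ x = 0 then g else 0)
        (fun p _ => by split_ifs <;> linarith) (Finset.mem_univ p₀))
      simp only [hp₀, true_and]
    · rw [← Finset.sum_filter, Finset.sum_const, nsmul_eq_mul]
      exact mul_le_mul_of_nonneg_right (by exact_mod_cast card_pairs_mem_le i) hl.le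
  rw [hsum, hbirth, mul_zero, add_zero,
    show π.d * (2 * (a * potentialDrift x)) = 2 * (π.v * K * l) * potentialDrift x by
      rw [← had]; ring]
  have hvKl : 0 < π.v * K * l := by positivity
  have hgame' := mul_le_mul_of_nonneg_left hgame hv.le
  rcases eq_or_ne x 0 with hx | hx
  · rw [if_pos hx] at hgame'
    refine (min_le_left _ _).trans ?_
    have := mul_le_mul_of_nonneg_left (neg_le_potentialDrift x) hvKl.le
    linarith
  · rw [if_neg hx] at hgame'
    refine (min_le_right _ _).trans ?_
    have := mul_le_mul_of_nonneg_left (one_le_potentialDrift hx) hvKl.le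
    linarith

/-- For a small exponent `θ`, the exponential of `-θ` times the corrected wealth of `i` does not
increase in mean, as long as `i` and its partner `c` are alive and there are no births. -/
lemma exists_exp_supermartingale [NeZero m] {π : Params} (hd : 0 < π.d) (hv : 0 < π.v)
    (hb : 0 < π.b) (hK : 0 < K) {g l : ℝ} (hl : 0 < l) (hgl : K * (1 + 2 * 8 ^ (2 * m)) * l < g)
    {i c : Fin K} (hic : i ≠ c) :
    ∃ a θ : ℝ, 0 < a ∧ 0 < θ ∧ ∀ σ : Config m K, (∀ k, σ.Z k ≠ Strategy.unborn) →
      σ.Alive i → σ.Alive c → PayoffBounds π (σ.Z i) (σ.Z c) g l →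
      ∫ u, Real.exp (-θ * correctedWealth a i c (σ.update π u)) ∂(π.markLaw K) ≤
        Real.exp (-θ * correctedWealth a i c σ) := by
  have := π.isProbabilityMeasure_markLaw hd hv hb hK
  obtain ⟨ε, hε, hmean⟩ := exists_le_integral_increment (m := m) hd hv hb hK hl hgl hic
  have hK' : (0 : ℝ) < K := by exact_mod_cast hK
  set a := π.v * K * l / π.d with ha
  have ha0 : 0 < a := by rw [ha]; positivity
  have hg0 : 0 < g := lt_trans (by positivity) hgl
  set B := a * 8 ^ (2 * m) + g + l with hB
  have hB0 : 0 < B := by rw [hB]; positivity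
  refine ⟨a, min (1 / B) (ε / B ^ 2), ha0, lt_min (by positivity) (by positivity),
    fun σ hborn hi hc hpay => ?_⟩
  set θ := min (1 / B) (ε / B ^ 2) with hθ
  have hθ0 : 0 < θ := lt_min (by positivity) (by positivity)
  have hθB : θ * B ≤ 1 := by
    have : θ ≤ 1 / B := min_le_left _ _
    rwa [le_div_iff₀ hB0] at this
  have hθε : θ * B ^ 2 ≤ ε := by
    have : θ ≤ ε / B ^ 2 := min_le_right _ _
    rwa [le_div_iff₀ (by positivity)] at this
  set x := σ.X i - σ.X c with hx
  have hpt : ∀ u : Mark K, Real.exp (-θ * correctedWealth a i c (σ.update π u)) ≤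
      Real.exp (-θ * correctedWealth a i c σ) *
        ((1 + θ ^ 2 * B ^ 2) - θ * increment a g l i c x u.1 u.2.1) := by
    intro u
    have h1 := correctedWealth_add_increment_le (a := a) hic hl.le hborn hi hc hpay u
    have h2 := abs_increment_le ha0.le hg0.le hl.le hic x u.1 u.2.1
    rw [← hx] at h1
    set φ := increment a g l i c x u.1 u.2.1
    have hab : |(-θ * φ)| ≤ 1 := by
      rw [abs_mul, abs_neg, abs_of_pos hθ0]
      exact (mul_le_mul_of_nonneg_left h2 hθ0.le).trans hθB
    have h3 := (abs_le.1 (Real.abs_exp_sub_one_sub_id_le hab)).2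
    have h4 : φ ^ 2 ≤ B ^ 2 := sq_le_sq' (abs_le.1 h2).1 (abs_le.1 h2).2
    have h5 : Real.exp (-θ * φ) ≤ (1 + θ ^ 2 * B ^ 2) - θ * φ := by
      have := mul_le_mul_of_nonneg_left h4 (sq_nonneg θ)
      have h6 : (-θ * φ) ^ 2 = θ ^ 2 * φ ^ 2 := by ring
      linarith
    calc Real.exp (-θ * correctedWealth a i c (σ.update π u))
        ≤ Real.exp (-θ * correctedWealth a i c σ + -θ * φ) := by
          refine Real.exp_le_exp.2 ?_
          have := mul_le_mul_of_nonneg_left h1 hθ0.le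
          linarith
      _ = Real.exp (-θ * correctedWealth a i c σ) * Real.exp (-θ * φ) := Real.exp_add _ _
      _ ≤ _ := mul_le_mul_of_nonneg_left h5 (Real.exp_pos _).le
  calc _ ≤ ∫ u : Mark K, Real.exp (-θ * correctedWealth a i c σ) *
        ((1 + θ ^ 2 * B ^ 2) - θ * increment a g l i c x u.1 u.2.1) ∂(π.markLaw K) :=
        integral_mono Integrable.of_finite Integrable.of_finite hpt
    _ = Real.exp (-θ * correctedWealth a i c σ) * ((1 + θ ^ 2 * B ^ 2) -
        θ * ∫ u : Mark K, increment a g l i c x u.1 u.2.1 ∂(π.markLaw K)) := by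
        rw [integral_const_mul, integral_sub Integrable.of_finite Integrable.of_finite,
          integral_const_mul, integral_const, probReal_univ, one_smul]
    _ ≤ Real.exp (-θ * correctedWealth a i c σ) * 1 := by
        refine mul_le_mul_of_nonneg_left ?_ (Real.exp_pos _).le
        have h1 := mul_le_mul_of_nonneg_left (hmean x) hθ0.le
        have h2 := mul_le_mul_of_nonneg_left hθε hθ0.le
        have h3 : θ * (θ * B ^ 2) = θ ^ 2 * B ^ 2 := by ring
        linarith
    _ = _ := mul_one _

/-! ### Survival of wealthy particles -/

/-- The configurations that the chain can visit from `σ` when no slot of `σ` is free: the behaviours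
are those of `σ`, and the particles that are dead in `σ` are dead. -/
def DeadStayDead (σ τ : Config m K) : Prop :=
  τ.Z = σ.Z ∧ ∀ i, ¬ σ.Alive i → τ.Y i ≤ 0

lemma DeadStayDead.update {π : Params} {σ τ : Config m K} (h : DeadStayDead σ τ)
    (hborn : ∀ i, σ.Z i ≠ Strategy.unborn) (u : Mark K) : DeadStayDead σ (τ.update π u) := by
  obtain ⟨hZ, hY⟩ := h
  refine ⟨funext fun i => ?_, fun i hi => ?_⟩
  · rw [Config.Z_update u (by rw [hZ]; exact hborn i), hZ]
  obtain ⟨c, e, x, s⟩ := u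
  cases c with
  | move k => exact hY i hi
  | game p =>
    simp only [Config.update, Config.game]
    split_ifs with hplay
    · have h1 : i ≠ p.1.1 := by rintro rfl; exact (hY _ hi).not_gt hplay.2.1.2
      have h2 : i ≠ p.1.2 := by rintro rfl; exact (hY _ hi).not_gt hplay.2.2.2
      simpa only [Function.update_of_ne h2, Function.update_of_ne h1] using hY i hi
    · exact hY i hi
  | birth k =>
    have h : ¬ (τ.Z k ≠ Strategy.unborn ∧ π.w_c < τ.Y k ∧ τ.freeSlots.Nonempty) := by
      rintro ⟨-, -, j, hj⟩
      simp only [Config.freeSlots, Finset.mem_filter] at hj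
      exact hborn j (by rw [← hZ]; exact hj.2)
    simpa only [Config.update, Config.birth, dif_neg h] using hY i hi

/-- The gain of a particle of behaviour `z` in a game with a cooperator; the value for an unborn
particle is arbitrary. -/
def Params.gain (π : Params) : Strategy → ℝ
  | Strategy.defect => π.T
  | _ => π.R

/-- The most that a particle of behaviour `z` can lose in a game; the value for an unborn particle is
arbitrary. -/
def Params.loss (π : Params) : Strategy → ℝ
  | Strategy.defect => 2 * π.P
  | _ => π.S

lemma Params.payoffBounds {π : Params} (hR : 0 < π.R) (hT : 0 < π.T) (hS : 0 < π.S)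
    (hP : 0 < π.P) {z : Strategy} (hz : z ≠ Strategy.unborn) :
    PayoffBounds π z Strategy.cooperate (π.gain z) (π.loss z) := by
  constructor <;> intro coin <;> try intro y <;> cases y
  all_goals
    cases z <;> cases coin <;> simp [Params.payoff, Params.gain, Params.loss] at hz ⊢ <;> linarith

/-- When no slot is free and another cooperator is alive for each particle, the living particles
survive forever with positive probability from some level of wealth on. -/
lemma exists_wealth_prob_aliveForever_pos [NeZero m] {π : Params} (hd : 0 < π.d) (hv : 0 < π.v)
    (hb : 0 < π.b) (hK : 0 < K) (hR : 0 < π.R) (hT : 0 < π.T) (hS : 0 < π.S) (hP : 0 < π.P)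
    (hSR : K * (1 + 2 * 8 ^ (2 * m)) * π.S < π.R)
    (hPT : K * (1 + 2 * 8 ^ (2 * m)) * (2 * π.P) < π.T)
    {σ : Config m K} (hσ : HasPartners σ) (hborn : ∀ i, σ.Z i ≠ Strategy.unborn) :
    ∃ M : Fin K → ℝ, ∀ τ : Config m K, DeadStayDead σ τ → (∀ i, σ.Alive i → M i ≤ τ.Y i) →
      0 < π.prob K (aliveForever π {i | σ.Alive i} τ) := by
  classical
  have := π.isProbabilityMeasure_markLaw hd hv hb hK
  have hK' : (0 : ℝ) < K := by exact_mod_cast hK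
  choose c hci hc hZc using hσ
  have hloss : ∀ i, 0 < π.loss (σ.Z i) := fun i => by
    cases σ.Z i <;> simp [Params.loss, hS, hP]
  have hgain : ∀ i, K * (1 + 2 * 8 ^ (2 * m)) * π.loss (σ.Z i) < π.gain (σ.Z i) := fun i => by
    cases σ.Z i <;> assumption
  choose a θ ha hθ hsuper using fun i =>
    exists_exp_supermartingale (m := m) hd hv hb hK (hloss i) (hgain i) (hci i).symm
  -- The normalising factor makes each term at least `1` when its particle is dead.
  set W : Fin K → Config m K → ℝ := fun i τ =>
    Real.exp (θ i * (a i * 8 ^ (2 * m))) * Real.exp (-θ i * correctedWealth (a i) i (c i) τ)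
    with hW
  have hWpos : ∀ i τ, 0 < W i τ := fun i τ => mul_pos (Real.exp_pos _) (Real.exp_pos _)
  have hbound : ∀ i τ, W i τ ≤ Real.exp (θ i * (a i * 8 ^ (2 * m) - τ.Y i)) := by
    intro i τ
    simp only [hW, ← Real.exp_add, correctedWealth]
    refine Real.exp_le_exp.2 ?_
    have h := mul_nonneg (hθ i).le (mul_nonneg (ha i).le
      (zero_le_one.trans (one_le_potential (τ.X i - τ.X (c i)))))
    linarith
  refine ⟨fun i => a i * 8 ^ (2 * m) + Real.log (K + 1) / θ i, fun τ hτ hM => ?_⟩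
  refine prob_aliveForever_pos_of_supermartingale hd hv hb hK {i | σ.Alive i} (DeadStayDead σ)
    (fun ρ => ∑ i with σ.Alive i, W i ρ) (fun ρ => Finset.sum_nonneg fun i _ => (hWpos i ρ).le)
    (fun ρ hρ u => hρ.update hborn u) ?_ ?_ τ hτ ?_
  · rintro ρ hρ ⟨i, hi, hdead⟩
    have hY : ρ.Y i ≤ 0 := by
      by_contra h
      exact hdead ⟨by rw [hρ.1]; exact hborn i, not_le.1 h⟩
    refine le_trans ?_ (Finset.single_le_sum (f := fun i => W i ρ) (fun i _ => (hWpos i ρ).le)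
      (Finset.mem_filter.2 ⟨Finset.mem_univ i, hi⟩))
    simp only [hW, ← Real.exp_add, correctedWealth]
    refine Real.one_le_exp ?_
    have h1 := mul_le_mul_of_nonneg_left (potential_le (ρ.X i - ρ.X (c i))) (ha i).le
    have h2 : 0 ≤ θ i * (a i * 8 ^ (2 * m) -
        (ρ.Y i + a i * potential (ρ.X i - ρ.X (c i)))) := mul_nonneg (hθ i).le (by linarith)
    linarith
  · intro ρ hρ halive
    rw [integral_finsetSum _ fun i _ => Integrable.of_finite]
    refine Finset.sum_le_sum fun i hi => ?_
    have hi : σ.Alive i := (Finset.mem_filter.1 hi).2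
    simp only [hW]
    rw [integral_const_mul]
    refine mul_le_mul_of_nonneg_left ?_ (Real.exp_pos _).le
    refine hsuper i ρ (fun k => by rw [hρ.1]; exact hborn k) (halive i hi) (halive _ (hc i)) ?_
    rw [hρ.1, hZc i]
    exact π.payoffBounds hR hT hS hP (hborn i)
  · have hK1 : (0 : ℝ) < K + 1 := by linarith
    have hterm : ∀ i, σ.Alive i → W i τ ≤ 1 / (K + 1) := by
      intro i hi
      refine (hbound i τ).trans ?_
      rw [one_div, ← Real.exp_log hK1, ← Real.exp_neg]
      refine Real.exp_le_exp.2 ?_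
      have h := mul_le_mul_of_nonneg_left (hM i hi) (hθ i).le
      have h' : θ i * (Real.log (K + 1) / θ i) = Real.log (K + 1) := by
        have := (hθ i).ne'
        field_simp
      rw [mul_add, h'] at h
      linarith
    calc ∑ i with σ.Alive i, W i τ ≤ ∑ i : Fin K with σ.Alive i, 1 / ((K : ℝ) + 1) :=
          Finset.sum_le_sum fun i hi => hterm i (Finset.mem_filter.1 hi).2
      _ ≤ ∑ _i : Fin K, 1 / ((K : ℝ) + 1) :=
          Finset.sum_le_univ_sum_of_nonneg fun _ => by positivity
      _ = K / (K + 1) := by simp [div_eq_mul_inv]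
      _ < 1 := by rw [div_lt_one hK1]; linarith

/-- From the given configuration, finitely many rings fill the slots and then enrich the living; from
there on, survival has positive probability. -/
lemma prob_neverDie_pos [NeZero m] {π : Params} (hd : 0 < π.d) (hv : 0 < π.v) (hb : 0 < π.b)
    (hK : 0 < K) (hR : 0 < π.R) (hT : 0 < π.T) (hS : 0 < π.S) (hP : 0 < π.P)
    (hw_c : π.w_0 < π.w_c) (hSR : K * (1 + 2 * 8 ^ (2 * m)) * π.S < π.R)
    (hPT : K * (1 + 2 * 8 ^ (2 * m)) * (2 * π.P) < π.T)
    {σ : Config m K} (hσ : HasPartners σ) : 0 < π.prob K (neverDie π σ) := by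
  obtain ⟨τ, hτ, hborn⟩ := exists_reachable_all_born hR hT hw_c hσ
  obtain ⟨M, hM⟩ := exists_wealth_prob_aliveForever_pos hd hv hb hK hR hT hS hP hSR hPT
    (hτ.hasPartners hσ) hborn
  obtain ⟨ρ, hρ, hZ, hdead, hwealth⟩ :=
    exists_reachable_wealth_forall hR hT (hτ.hasPartners hσ) M
  have hpos : 0 < π.prob K (aliveForever π {i | τ.Alive i} ρ) := by
    refine hM ρ ⟨hZ, fun i hi => ?_⟩ hwealth
    rw [hdead i hi]
    by_contra h
    exact hi ⟨hborn i, not_le.1 h⟩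
  have hsub : aliveForever π {i | τ.Alive i} ρ ⊆ aliveForever π {i | σ.Alive i} ρ :=
    fun ω h n i hi => h n i (hτ.alive hi)
  exact ((hτ.trans hρ).prob_aliveForever_pos hd hv hb hK (fun i hi => hi)
    (hpos.trans_le (measure_mono hsub))).trans_le (measure_mono (aliveForever_subset_neverDie π σ))

end PrisonersDilemma

open PrisonersDilemma in
theorem mainTheorem2 (m K : ℕ) (hm : 0 < m) (hK : 0 < K) (d v w_c w_0 : ℝ)
    (hd : 0 < d) (hv : 0 < v) (hw_0 : 0 < w_0) (hw_c : w_0 < w_c) :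
    ∃ ν ν' : ℝ, 0 < ν ∧ 0 < ν' ∧
      ∀ b R S T P : ℝ, 0 < b → 0 < R → R < T → 0 < P → P < S →
        ν * (S + w_0) < R → ν' * (2 * P + w_0) < T →
        ∀ σ : Config m K, σ.TwoCooperatorsOneDefector →
          0 < Params.prob ⟨d, v, b, w_c, w_0, R, S, T, P⟩ K
            (neverDie ⟨d, v, b, w_c, w_0, R, S, T, P⟩ σ) := by
  have : NeZero m := ⟨hm.ne'⟩
  have hν : (0 : ℝ) < K * (1 + 2 * 8 ^ (2 * m)) :=
    mul_pos (by exact_mod_cast hK) (by positivity)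
  refine ⟨_, _, hν, hν, fun b R S T P hb hR hRT hP hPS h1 h2 σ hσ => ?_⟩
  -- The births are all over before the supermartingale is used, so `w_0` plays no role in the bound.
  have hνw := mul_pos hν hw_0
  rw [mul_add] at h1 h2
  exact prob_neverDie_pos hd hv hb hK hR (hR.trans hRT) (hP.trans hPS) hP hw_c
    (lt_of_le_of_lt (le_add_of_nonneg_right hνw.le) h1)
    (lt_of_le_of_lt (le_add_of_nonneg_right hνw.le) h2) hσ.hasPartners
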